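/- All graphs are finite, simple and undirected. A graph $G$ is $k$-vertex-critical if $\chi(G)=k$ and $\chi(G-v)<k$ for every vertex $v$ of $G$; it is $(H_1,H_2)$-free if no induced subgraph of $G$ is isomorphic to $H_1$ or to $H_2$. $P_t$ denotes the path on $t$ vertices, $+$ denotes disjoint union, $\overline{G}$ is the complement of $G$, and the gem is the graph obtained from $P_4$ by adding a vertex adjacent to all four vertices of the path. Graphs are counted up to isomorphism and given by adjacency lists. (a) There are exactly 3 four-vertex-critical $(P_5,\text{gem})$-free graphs, namely 1. $\{0: 1\,2\,3;\ 1: 0\,2\,3;\ 2: 0\,1\,3;\ 3: 0\,1\,2\}$ (that is, $K_4$); 2. $\{0: 1\,4\,5;\ 1: 0\,2\,5\,6;\ 2: 1\,3\,6;\ 3: 2\,4\,6;\ 4: 0\,3\,5;\ 5: 0\,1\,4;\ 6: 1\,2\,3\}$; 3. $\{0: 1\,4\,5;\ 1: 0\,2\,5\,6\,7;\ 2: 1\,3\,7;\ 3: 2\,4\,6;\ 4: 0\,3\,5\,6\,7;\ 5: 0\,1\,4;\ 6: 1\,3\,4\,8\,9;\ 7: 1\,2\,4\,8\,9;\ 8: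 6\,7\,9;\ 9: 6\,7\,8\}$. (b) There are exactly 6 four-vertex-critical $(P_5,\overline{P_3+P_2})$-free graphs, namely 1. $\{0: 1\,2\,3;\ 1: 0\,2\,3;\ 2: 0\,1\,3;\ 3: 0\,1\,2\}$ (that is, $K_4$); 2. $\{0: 1\,4\,5;\ 1: 0\,2\,5;\ 2: 1\,3\,5;\ 3: 2\,4\,5;\ 4: 0\,3\,5;\ 5: 0\,1\,2\,3\,4\}$; 3. $\{0: 1\,4\,5;\ 1: 0\,2\,5\,6;\ 2: 1\,3\,6;\ 3: 2\,4\,6;\ 4: 0\,3\,5;\ 5: 0\,1\,4;\ 6: 1\,2\,3\}$; 4. $\{0: 1\,4\,5\,6;\ 1: 0\,2\,5\,6;\ 2: 1\,3\,5;\ 3: 2\,4\,6;\ 4: 0\,3\,5;\ 5: 0\,1\,2\,4;\ 6: 0\,1\,3\}$; 5. $\{0: 1\,4\,5\,6;\ 1: 0\,2\,5\,6;\ 2: 1\,3\,5\,6;\ 3: 2\,4\,6;\ 4: 0\,3\,5;\ 5: 0\,1\,2\,4;\ 6: 0\,1\,2\,3\}$; 6. $\{0: 1\,4\,5\,6;\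 1: 0\,2\,5\,6;\ 2: 1\,3\,6;\ 3: 2\,4\,6;\ 4: 0\,3\,5;\ 5: 0\,1\,4;\ 6: 0\,1\,2\,3\}$. -/

import Mathlib

namespace VertexCritical

/-- `G` is `k`-vertex-critical: `χ(G) = k` and `χ(G - v) < k` for every vertex `v`. -/
def IsVertexCritical {V : Type*} (G : SimpleGraph V) (k : ℕ) : Prop :=
  G.chromaticNumber = k ∧ ∀ v : V, (G.induce ({v}ᶜ : Set V)).chromaticNumber < k

/-- `G` is `H`-free: no induced subgraph of `G` is isomorphic to `H`. -/
def IsFree {V W : Type*} (H : SimpleGraph W) (G : SimpleGraph V) : Prop :=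
  ¬ H.IsIndContained G

/-- The graph on `{0, …, n - 1}` with the given adjacency lists (all lists used below are
symmetric and loopless). -/
def ofAdjLists {n : ℕ} (adj : Fin n → List (Fin n)) : SimpleGraph (Fin n) :=
  SimpleGraph.fromRel fun i j => j ∈ adj i

/-- The path on five vertices. -/
abbrev P5 : SimpleGraph (Fin 5) := SimpleGraph.pathGraph 5

/-- The gem: the path `0 - 1 - 2 - 3` together with a vertex `4` adjacent to all of it. -/
def gem : SimpleGraph (Fin 5) :=
  ofAdjLists ![[1, 4], [0, 2, 4], [1, 3, 4], [2, 4], [0, 1, 2, 3]]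

/-- The complement of the disjoint union of a path on three and a path on two vertices. -/
def coP3P2 : SimpleGraph (Fin 3 ⊕ Fin 2) :=
  (SimpleGraph.pathGraph 3 ⊕g SimpleGraph.pathGraph 2)ᶜ

/-- Finite graphs with vertex set `{0, …, n - 1}`, for any `n`. -/
abbrev FinGraph : Type := Σ n : ℕ, SimpleGraph (Fin n)

/-- Graph isomorphism as an equivalence relation. -/
instance isoSetoid : Setoid FinGraph where
  r G H := Nonempty (G.2 ≃g H.2)
  iseqv :=
    { refl := fun _ => ⟨SimpleGraph.Iso.refl⟩
      symm := fun ⟨e⟩ => ⟨e.symm⟩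
      trans := fun ⟨e⟩ ⟨f⟩ => ⟨e.trans f⟩ }

/-- The set of isomorphism classes of finite `k`-vertex-critical `(P₅, H)`-free graphs. -/
def criticalClasses {W : Type*} (k : ℕ) (H : SimpleGraph W) : Set (Quotient isoSetoid) :=
  {c | ∃ G : FinGraph, IsVertexCritical G.2 k ∧ IsFree P5 G.2 ∧ IsFree H G.2 ∧ c = ⟦G⟧}

/-- The three listed 4-vertex-critical `(P₅, gem)`-free graphs. -/
def gemList : List FinGraph :=
  [⟨4, ofAdjLists ![[1, 2, 3], [0, 2, 3], [0, 1, 3], [0, 1, 2]]⟩,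
   ⟨7, ofAdjLists ![[1, 4, 5], [0, 2, 5, 6], [1, 3, 6], [2, 4, 6], [0, 3, 5], [0, 1, 4],
      [1, 2, 3]]⟩,
   ⟨10, ofAdjLists ![[1, 4, 5], [0, 2, 5, 6, 7], [1, 3, 7], [2, 4, 6], [0, 3, 5, 6, 7],
      [0, 1, 4], [1, 3, 4, 8, 9], [1, 2, 4, 8, 9], [6, 7, 9], [6, 7, 8]]⟩]

/-- The six listed 4-vertex-critical `(P₅, co-(P₃ + P₂))`-free graphs. -/
def coP3P2List : List FinGraph :=
  [⟨4, ofAdjLists ![[1, 2, 3], [0, 2, 3], [0, 1, 3], [0, 1, 2]]⟩,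
   ⟨6, ofAdjLists ![[1, 4, 5], [0, 2, 5], [1, 3, 5], [2, 4, 5], [0, 3, 5], [0, 1, 2, 3, 4]]⟩,
   ⟨7, ofAdjLists ![[1, 4, 5], [0, 2, 5, 6], [1, 3, 6], [2, 4, 6], [0, 3, 5], [0, 1, 4],
      [1, 2, 3]]⟩,
   ⟨7, ofAdjLists ![[1, 4, 5, 6], [0, 2, 5, 6], [1, 3, 5], [2, 4, 6], [0, 3, 5], [0, 1, 2, 4],
      [0, 1, 3]]⟩,
   ⟨7, ofAdjLists ![[1, 4, 5, 6], [0, 2, 5, 6], [1, 3, 5, 6], [2, 4, 6], [0, 3, 5],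
      [0, 1, 2, 4], [0, 1, 2, 3]]⟩,
   ⟨7, ofAdjLists ![[1, 4, 5, 6], [0, 2, 5, 6], [1, 3, 6], [2, 4, 6], [0, 3, 5], [0, 1, 4],
      [0, 1, 2, 3]]⟩]

end VertexCritical

/-!
A `k + 1`-vertex-critical graph has no endomorphism that misses a vertex, since a `k`-colouring of
the graph without that vertex would pull back along it. Let `H` be a `k`-colourable induced subgraph
of a critical graph `G`. If an endomorphism of `H` moves only a vertex or the two ends of an edge,
and misses them, then it does not extend to `G` by the identity, so some vertex outside of `H` is
adjacent to a moved vertex but not to its image. This leaves finitely many possibilities for the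
trace of that vertex, its neighbourhood in `H`, and fewer still as no vertex may complete a copy of
a forbidden graph. Branching on which trace occurs yields a finite search that starts from a single
vertex. Its leaves are graphs that are not `k`-colourable; each contains a listed graph, and `G`
equals that graph because critical graphs do not properly contain each other.

Traces and sets of traces are encoded as binary numbers, on which the kernel runs the search.
-/

namespace VertexCritical

noncomputable section

/-! ### Critical graphs -/

section Critical

variable {V W : Type*} {G : SimpleGraph V} {H : SimpleGraph W} {k : ℕ}

theorem colorable_succ_of_colorable_compl {v : V} (h : (G.induce {v}ᶜ).Colorable k) :
    G.Colorable (k + 1) := by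
  classical
  obtain ⟨C⟩ := h
  refine ⟨.mk (fun x => if hx : x = v then Fin.last k else (C ⟨x, hx⟩).castSucc) ?_⟩
  intro x y hxy
  by_cases hx : x = v <;> by_cases hy : y = v
  · exact absurd (hx.trans hy.symm) hxy.ne
  · simpa [hx, hy] using (Fin.castSucc_lt_last _).ne'
  · simp [hx, hy]
  · simpa [hx, hy] using C.valid (v := ⟨x, hx⟩) (w := ⟨y, hy⟩) hxy

theorem chromaticNumber_lt_succ_iff : G.chromaticNumber < (k + 1 : ℕ) ↔ G.Colorable k := by
  rw [← SimpleGraph.chromaticNumber_le_iff_colorable, Nat.cast_add_one,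
    ENat.lt_add_one_iff (by simp)]

theorem isVertexCritical_succ_iff :
    IsVertexCritical G (k + 1) ↔
      ¬ G.Colorable k ∧ ∀ v, (G.induce ({v}ᶜ : Set V)).Colorable k := by
  rw [← chromaticNumber_lt_succ_iff, not_lt, IsVertexCritical]
  simp only [chromaticNumber_lt_succ_iff]
  refine and_congr_left fun hdel => ⟨ge_of_eq, fun h => ?_⟩
  refine le_antisymm (SimpleGraph.chromaticNumber_le_iff_colorable.2 ?_) h
  cases isEmpty_or_nonempty V with
  | inl _ => exact .of_isEmpty _
  | inr hV => exact colorable_succ_of_colorable_compl (hdel hV.some)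

theorem IsVertexCritical.surjective_hom (hG : IsVertexCritical G (k + 1)) (hH : ¬ H.Colorable k)
    (φ : H →g G) : Function.Surjective φ := by
  intro v
  by_contra! hv
  refine hH (((isVertexCritical_succ_iff.1 hG).2 v).of_hom (f := ?_))
  exact ⟨fun x => ⟨φ x, hv x⟩, φ.map_rel⟩

theorem IsVertexCritical.nonempty_iso (hG : IsVertexCritical G (k + 1)) (hH : ¬ H.Colorable k)
    (h : H.IsIndContained G) : Nonempty (G ≃g H) := by
  obtain ⟨φ⟩ := h
  exact ⟨(RelIso.ofSurjective φ (hG.surjective_hom hH φ.toHom)).symm⟩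

theorem IsVertexCritical.exists_adj_outside (hG : IsVertexCritical G (k + 1)) {s : Set V}
    (hs : s.Nonempty) (hcol : (G.induce s).Colorable k) : ∃ x ∉ s, ∃ y ∈ s, G.Adj x y := by
  classical
  obtain ⟨v, hv⟩ := hs
  obtain ⟨hchi, hdel⟩ := isVertexCritical_succ_iff.1 hG
  obtain ⟨C⟩ := hcol
  obtain ⟨D⟩ := hdel v
  by_contra! h
  refine hchi ⟨.mk (fun x => if hx : x ∈ s then C ⟨x, hx⟩
    else D ⟨x, fun hxv => hx (hxv ▸ hv)⟩) fun {x y} hxy => ?_⟩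
  by_cases hx : x ∈ s <;> by_cases hy : y ∈ s
  · simpa [hx, hy] using C.valid (v := ⟨x, hx⟩) (w := ⟨y, hy⟩) hxy
  · exact absurd hxy.symm (h y hy x hx)
  · exact absurd hxy (h x hx y hy)
  · simpa [hx, hy] using D.valid (v := ⟨x, _⟩) (w := ⟨y, _⟩) hxy

theorem IsVertexCritical.of_iso (e : G ≃g H) (hH : IsVertexCritical H (k + 1)) :
    IsVertexCritical G (k + 1) := by
  rw [isVertexCritical_succ_iff] at hH ⊢
  refine ⟨fun h => hH.1 (h.of_hom e.symm.toHom), fun v => (hH.2 (e v)).of_hom (f := ?_)⟩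
  exact ⟨fun x => ⟨e x, fun h => x.2 (e.injective h)⟩, e.map_rel_iff.2⟩

theorem IsFree.of_iso {U : Type*} {F : SimpleGraph U} (e : G ≃g H) (hH : IsFree F H) :
    IsFree F G := fun ⟨φ⟩ => hH ⟨e.toEmbedding.comp φ⟩

end Critical

/-! ### Sets of vertices as bit masks -/

/-- The set `{v | p v}` of entries of a list as a binary number, the last entry of the list being
the lowest bit, so that masks do not change when the list grows at its head. -/
def mask {V : Type*} (p : V → Bool) : List V → ℕ
  | [] => 0
  | v :: vs => bif p v then mask p vs ||| 2 ^ vs.length else mask p vs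

/-- The masks `a` and `b` represent disjoint sets. -/
def disjoint (a b : ℕ) : Bool := Nat.beq (Nat.land a b) 0

/-- The mask of a set difference. -/
def diff (a b : ℕ) : ℕ := Nat.xor a (Nat.land a b)

/-- The mask `a` represents a subset of the set represented by `b`. -/
def submask (a b : ℕ) : Bool := Nat.beq (Nat.land a b) a

/-- The part of `a` inside `b` or outside `b`, as prescribed by a sign. -/
def restrict (inside : Bool) (b a : ℕ) : ℕ := bif inside then Nat.land a b else diff a b

theorem testBit_diff (a b i : ℕ) : (diff a b).testBit i = (a.testBit i && !b.testBit i) := by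
  change (a ^^^ (a &&& b)).testBit i = _
  cases h : a.testBit i <;> simp [h]

theorem testBit_restrict (s : Bool) (a b i : ℕ) :
    (restrict s b a).testBit i = (a.testBit i && b.testBit i == s) := by
  cases s
  · simp [restrict, testBit_diff]
  · simp [restrict]

section Mask

variable {V : Type*} (p q : V → Bool) (vs : List V)

theorem testBit_mask (i : ℕ) : (mask p vs).testBit i = vs.reverse[i]?.any p := by
  induction vs with
  | nil => simp [mask]
  | cons v vs ih =>
    have hlast : (mask p (v :: vs)).testBit i =
        ((mask p vs).testBit i || (p v && decide (vs.length = i))) := by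
      cases hv : p v <;> simp [mask, hv, Nat.testBit_or, Nat.testBit_two_pow]
    rw [hlast, ih, List.reverse_cons]
    rcases lt_trichotomy i vs.length with hi | rfl | hi
    · rw [List.getElem?_append_left (by simpa using hi)]
      simp [hi.ne']
    · simp
    · rw [List.getElem?_eq_none (by simpa using hi.le), List.getElem?_eq_none (by simpa using hi)]
      simp [hi.ne]

theorem mask_false : mask (fun _ => false) vs = 0 :=
  Nat.eq_of_testBit_eq fun i => by simp [testBit_mask]

theorem mask_true : mask (fun _ => true) vs = 2 ^ vs.length - 1 :=
  Nat.eq_of_testBit_eq fun i => by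
    rw [testBit_mask, Nat.testBit_two_pow_sub_one, Option.any_true]
    grind

variable {p q vs}

theorem mask_eq_mask_iff : mask p vs = mask q vs ↔ ∀ v ∈ vs, p v = q v := by
  refine ⟨fun h v hv => ?_, fun h => Nat.eq_of_testBit_eq fun i => ?_⟩
  · obtain ⟨i, hi⟩ := List.mem_iff_getElem?.1 (List.mem_reverse.2 hv)
    simpa [testBit_mask, hi] using congrArg (Nat.testBit · i) h
  · rw [testBit_mask, testBit_mask]
    cases hi : vs.reverse[i]? with
    | none => rfl
    | some v => exact h v (List.mem_reverse.1 (List.mem_of_getElem? hi))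

variable (p q vs)

theorem mask_lor : Nat.lor (mask p vs) (mask q vs) = mask (fun v => p v || q v) vs :=
  Nat.eq_of_testBit_eq fun i => by
    change (mask p vs ||| mask q vs).testBit i = _
    simp only [Nat.testBit_or, testBit_mask]
    cases vs.reverse[i]? <;> rfl

theorem mask_land : Nat.land (mask p vs) (mask q vs) = mask (fun v => p v && q v) vs :=
  Nat.eq_of_testBit_eq fun i => by
    change (mask p vs &&& mask q vs).testBit i = _
    simp only [Nat.testBit_and, testBit_mask]
    cases vs.reverse[i]? <;> rfl

theorem diff_mask : diff (mask p vs) (mask q vs) = mask (fun v => p v && !q v) vs :=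
  Nat.eq_of_testBit_eq fun i => by
    simp only [testBit_diff, testBit_mask]
    cases vs.reverse[i]? <;> rfl

theorem restrict_mask (s : Bool) :
    restrict s (mask q vs) (mask p vs) = mask (fun v => p v && q v == s) vs :=
  Nat.eq_of_testBit_eq fun i => by
    simp only [testBit_restrict, testBit_mask]
    cases vs.reverse[i]? <;> rfl

variable {p q vs}

theorem beq_mask_zero : Nat.beq (mask p vs) 0 = true ↔ ∀ v ∈ vs, p v = false := by
  rw [Nat.beq_eq, ← mask_false vs, mask_eq_mask_iff]

theorem disjoint_mask : disjoint (mask p vs) (mask q vs) = true ↔ ∀ v ∈ vs, p v → q v = false := by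
  rw [disjoint, mask_land, beq_mask_zero]
  simp

theorem submask_mask : submask (mask p vs) (mask q vs) = true ↔ ∀ v ∈ vs, p v → q v := by
  rw [submask, mask_land, Nat.beq_eq, mask_eq_mask_iff]
  simp

theorem mask_lt (p : V → Bool) (vs : List V) : mask p vs < 2 ^ vs.length :=
  Nat.lt_pow_two_of_testBit _ fun i hi => by
    rw [testBit_mask, List.getElem?_eq_none (by simpa using hi), Option.any_none]

theorem mask_cons_of_true {v : V} (h : p v = true) :
    mask p (v :: vs) = 2 ^ vs.length + mask p vs := by
  simpa [mask, h, Nat.or_comm] using (Nat.two_pow_add_eq_or_of_lt (mask_lt p vs) 1).symm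

theorem mask_cons_of_false {v : V} (h : p v = false) : mask p (v :: vs) = mask p vs := by
  rw [mask, h, cond_false]

end Mask

/-! ### Graphs as lists of rows -/

/-- What the search knows about a vertex `v` of a list `vs`. The *trace* of a vertex `x` on `vs` is
the mask of the neighbours of `x`, and sets of traces are represented by natural numbers again: bit
number `t` of such a number tells whether `t` is in the set. -/
structure Row where
  /-- The mask of `{v}`. -/
  bit : ℕ
  /-- The mask of the neighbours of `v`. -/
  nbrs : ℕ
  /-- The set of all masks that contain `v`. -/
  table : ℕ

/-- Passes from a set of masks to its preimage under forgetting the bit number `n`, where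
`N = 2 ^ n` and all masks in the set have only the bits below `n`. -/
def double (N A : ℕ) : ℕ := Nat.lor A (Nat.shiftLeft A N)

theorem testBit_double_of_testBit {A i : ℕ} (N : ℕ) (h : A.testBit i) :
    (double N A).testBit i ∧ (double N A).testBit (N + i) := by
  change (A ||| A <<< N).testBit i ∧ (A ||| A <<< N).testBit (N + i)
  simp [Nat.testBit_or, Nat.testBit_shiftLeft, h]

theorem testBit_double {N A i : ℕ} (hi : i < N) (hA : A < 2 ^ N) :
    (double N A).testBit i = A.testBit i ∧ (double N A).testBit (N + i) = A.testBit i := by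
  change (A ||| A <<< N).testBit i = _ ∧ (A ||| A <<< N).testBit (N + i) = _
  have hhigh : A.testBit (N + i) = false :=
    Nat.testBit_lt_two_pow (hA.trans_le (Nat.pow_le_pow_right two_pos (Nat.le_add_right N i)))
  simp [Nat.testBit_or, Nat.testBit_shiftLeft, hi.not_ge, hhigh]

theorem double_lt {N A : ℕ} (hA : A < 2 ^ N) : double N A < 2 ^ (2 * N) := by
  change A ||| A <<< N < _
  refine Nat.or_lt_two_pow (hA.trans_le (Nat.pow_le_pow_right two_pos (by lia))) ?_
  rw [Nat.shiftLeft_eq, two_mul, pow_add]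
  exact Nat.mul_lt_mul_of_pos_right hA (by positivity)

/-- The masks of length `2 * N` that contain the highest bit. -/
def upperHalf (N : ℕ) : ℕ := Nat.shiftLeft (Nat.sub (Nat.pow 2 N) 1) N

theorem testBit_upperHalf {N i : ℕ} (hi : i < N) :
    (upperHalf N).testBit i = false ∧ (upperHalf N).testBit (N + i) = true := by
  change ((2 ^ N - 1) <<< N).testBit i = _ ∧ ((2 ^ N - 1) <<< N).testBit (N + i) = _
  simp [Nat.testBit_shiftLeft, hi.not_ge, hi]

theorem upperHalf_lt (N : ℕ) : upperHalf N < 2 ^ (2 * N) := by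
  change (2 ^ N - 1) <<< N < _
  rw [Nat.shiftLeft_eq, two_mul, pow_add]
  exact Nat.mul_lt_mul_of_pos_right (Nat.sub_lt (by positivity) one_pos) (by positivity)

/-- The set of masks of subsets of `vs` that contain `v`. -/
def truthTable {V : Type*} [DecidableEq V] (v : V) : List V → ℕ
  | [] => 0
  | w :: vs => bif decide (w = v) then upperHalf (2 ^ vs.length)
      else double (2 ^ vs.length) (truthTable v vs)

/-- Adds a new vertex with trace `t` to a list of rows. -/
def extend (h : List Row) (t : ℕ) : List Row :=
  let N := Nat.pow 2 h.length
  ⟨N, t, upperHalf N⟩ :: h.map fun r =>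
    ⟨r.bit, bif disjoint t r.bit then r.nbrs else Nat.lor r.nbrs N, double N r.table⟩

section Code

variable {V : Type*} [DecidableEq V]

theorem truthTable_lt (v : V) (vs : List V) : truthTable v vs < 2 ^ 2 ^ vs.length := by
  induction vs with
  | nil => simp [truthTable]
  | cons w vs ih =>
    rw [truthTable, List.length_cons, pow_succ' 2 vs.length]
    cases decide (w = v)
    · exact double_lt ih
    · exact upperHalf_lt _

theorem testBit_truthTable {v : V} {vs : List V} (hv : v ∈ vs) (p : V → Bool) :
    (truthTable v vs).testBit (mask p vs) = p v := by
  induction vs with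
  | nil => simp at hv
  | cons w vs ih =>
    have hm := mask_lt p vs
    rw [truthTable]
    by_cases hw : w = v
    · subst hw
      cases hp : p w
      · simpa [mask_cons_of_false hp] using (testBit_upperHalf hm).1
      · simpa [mask_cons_of_true hp] using (testBit_upperHalf hm).2
    · have hdouble := testBit_double hm (truthTable_lt v vs)
      rw [ih ((List.mem_cons.1 hv).resolve_left (Ne.symm hw))] at hdouble
      cases hp : p w
      · simpa [mask_cons_of_false hp, hw] using hdouble.1
      · simpa [mask_cons_of_true hp, hw] using hdouble.2

variable (G : SimpleGraph V) [DecidableRel G.Adj]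

/-- The trace of `x` on `vs`. -/
def trace (vs : List V) (x : V) : ℕ := mask (fun v => decide (G.Adj x v)) vs

/-- The row of the vertex `v` of `vs`. -/
def row (vs : List V) (v : V) : Row :=
  ⟨mask (fun w => decide (w = v)) vs, trace G vs v, truthTable v vs⟩

/-- The subgraph of `G` induced on `vs` as a list of rows. -/
def code (vs : List V) : List Row := vs.map (row G vs)

theorem code_cons {v : V} {vs : List V} (hv : v ∉ vs) :
    code G (v :: vs) = extend (code G vs) (trace G vs v) := by
  have hdisj (w : V) (hw : w ∈ vs) :
      disjoint (trace G vs v) (row G vs w).bit = !decide (G.Adj v w) := by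
    rw [Bool.eq_iff_iff, row, trace, disjoint_mask]
    simp only [decide_eq_true_eq, decide_eq_false_iff_not, Bool.not_eq_true']
    exact ⟨fun h hvw => h w hw hvw rfl, fun h u _ hvu huw => h (huw ▸ hvu)⟩
  have hbit : mask (fun w => decide (w = v)) vs = 0 := by
    rw [← mask_false vs, mask_eq_mask_iff]
    exact fun w hw => decide_eq_false fun h => hv (h ▸ hw)
  simp only [extend, code, List.map_cons, List.map_map, List.length_map]
  congr 1
  · simp [row, trace, mask, truthTable, hbit]
  · refine List.map_congr_left fun w hw => ?_
    have hvw : v ≠ w := fun h => hv (h ▸ hw)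
    simp only [Function.comp_apply, hdisj w hw]
    cases hadj : decide (G.Adj v w) <;>
      simp_all [row, trace, mask, truthTable, G.adj_comm w v, Nat.lor]
    rfl

end Code

/-! ### Searching for induced subgraphs -/

/- The loops below are written with recursors because the kernel evaluates those several times
faster than compiled pattern matching. -/

/-- The union of the values of `f` at the rows of the vertices in the mask `c`. -/
def union (f : Row → ℕ) (h : List Row) : ℕ → ℕ :=
  List.rec (fun _ => 0)
    (fun r _ ih c => bif Nat.beq c 0 then 0 else bif disjoint c r.bit then ih c
      else Nat.lor (f r) (ih (diff c r.bit))) h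

/-- The part of the mask `c` that lies inside or outside of given masks, as prescribed by a list
of signs. -/
def candidates (s : List Bool) : List ℕ → ℕ → ℕ :=
  List.rec (fun _ c => c)
    (fun b _ ih ms c => List.rec c (fun m ms _ => ih ms (restrict b m c)) ms) s

/-- A graph as a list of vertices to be placed one after the other: the required adjacency of each
vertex to a distinguished vertex, and its required adjacencies to the vertices before it, the last
one first. -/
abbrev Pattern : Type := List (Bool × List Bool)

/-- Those traces in `A` for which the vertices of the pattern can be mapped to distinct vertices in
the mask `free`, the distinguished vertex being mapped to a vertex with that trace, where `ms` are
the masks of neighbours of the vertices already placed. -/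
def completions (h : List Row) (P : Pattern) : List ℕ → ℕ → ℕ → ℕ :=
  List.rec (fun _ _ A => A)
    (fun p _ ih ms free A => bif Nat.beq A 0 then 0 else
      union (fun r => ih (r.nbrs :: ms) (diff free r.bit) (restrict p.1 r.table A)) h
        (candidates p.2 ms free)) P

/-- The pattern of the graph `P`, whose vertices are placed in the given order after those in a
second list, where `a` prescribes the adjacencies to the distinguished vertex. -/
def pattern {W : Type*} (P : SimpleGraph W) [DecidableRel P.Adj] (a : W → Bool) :
    List W → List W → Pattern
  | [], _ => []
  | w :: ws, placed => (a w, placed.map fun q => decide (P.Adj w q)) :: pattern P a ws (w :: placed)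

section Placement

variable {V W : Type*} (G : SimpleGraph V) (P : SimpleGraph W)

/-- The map `f` keeps the vertices `q` and `r` apart, and preserves and reflects their
adjacency. -/
def IsEmbeddedAt (f : W → V) (q r : W) : Prop :=
  f q ≠ f r ∧ (G.Adj (f q) (f r) ↔ P.Adj q r)

/-- The map `f` places the vertices `ws`, after those of `placed`, in `vs` as the pattern of `P`
demands if `p` tells which vertices are adjacent to the distinguished one. -/
def IsPlacement (vs : List V) (a : W → Bool) (p : V → Bool) (ws placed : List W) (f : W → V) :
    Prop :=
  (∀ w ∈ ws, f w ∈ vs ∧ p (f w) = a w) ∧ (ws.reverse ++ placed).Pairwise (IsEmbeddedAt G P f)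

theorem isPlacement_cons {vs : List V} {a : W → Bool} {p : V → Bool} {w : W} {ws placed : List W}
    {f : W → V} :
    IsPlacement G P vs a p (w :: ws) placed f ↔
      (f w ∈ vs ∧ p (f w) = a w) ∧ IsPlacement G P vs a p ws (w :: placed) f := by
  simp [IsPlacement, and_assoc]

variable {G P}

theorem IsEmbeddedAt.congr {f g : W → V} {s : Set W} (hfg : Set.EqOn f g s) {q r : W} (hq : q ∈ s)
    (hr : r ∈ s) : IsEmbeddedAt G P f q r ↔ IsEmbeddedAt G P g q r := by
  rw [IsEmbeddedAt, IsEmbeddedAt, hfg hq, hfg hr]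

theorem isIndContained_of_pairwise {ws : List W} (hws : ∀ w, w ∈ ws) {f : W → V}
    (hf : ws.Pairwise (IsEmbeddedAt G P f)) : P.IsIndContained G := by
  have : Std.Symm (IsEmbeddedAt G P f) :=
    ⟨fun q r h => ⟨h.1.symm, by rw [G.adj_comm, P.adj_comm, h.2]⟩⟩
  have hpair {q r : W} (hqr : q ≠ r) : IsEmbeddedAt G P f q r := hf.forall (hws q) (hws r) hqr
  refine ⟨⟨⟨f, fun q r h => by_contra fun hqr => (hpair hqr).1 h⟩, fun {q r} => ?_⟩⟩
  by_cases hqr : q = r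
  · simp [hqr]
  · exact (hpair hqr).2

theorem pairwise_update_cons [DecidableEq W] {w : W} {placed : List W} (hw : w ∉ placed)
    {f : W → V} (hf : placed.Pairwise (IsEmbeddedAt G P f)) (v : V) :
    (w :: placed).Pairwise (IsEmbeddedAt G P (Function.update f w v)) ↔
      v ∉ placed.map f ∧ ∀ q ∈ placed, G.Adj (f q) v ↔ P.Adj w q := by
  have hupdate (q : W) (hq : q ∈ placed) : Function.update f w v q = f q :=
    Function.update_of_ne (ne_of_mem_of_not_mem hq hw) v f
  have htail : placed.Pairwise (IsEmbeddedAt G P (Function.update f w v)) :=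
    hf.imp_of_mem fun hq hr h => (IsEmbeddedAt.congr hupdate hq hr).2 h
  rw [List.pairwise_cons, and_iff_left htail]
  simp only [IsEmbeddedAt, Function.update_self]
  grind [G.adj_comm]

theorem exists_isPlacement_cons [DecidableEq W] {vs : List V} {a : W → Bool} {p : V → Bool}
    {w : W} {ws placed : List W} {f : W → V} (hw : w ∉ placed) :
    (∃ g, Set.EqOn g f {q | q ∈ placed} ∧ IsPlacement G P vs a p (w :: ws) placed g) ↔
      ∃ v ∈ vs, p v = a w ∧ (w :: placed).Pairwise (IsEmbeddedAt G P (Function.update f w v)) ∧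
        ∃ g, Set.EqOn g (Function.update f w v) {q | q ∈ w :: placed} ∧
          IsPlacement G P vs a p ws (w :: placed) g := by
  constructor
  · rintro ⟨g, hgf, hg⟩
    obtain ⟨⟨hvs, hpa⟩, hg⟩ := (isPlacement_cons G P).1 hg
    have hgf' : Set.EqOn g (Function.update f w (g w)) {q | q ∈ w :: placed} := by
      intro q hq
      rcases eq_or_ne q w with rfl | hqw
      · simp
      · rw [Function.update_of_ne hqw]
        exact hgf ((List.mem_cons.1 hq).resolve_left hqw)
    refine ⟨g w, hvs, hpa, ?_, g, hgf', hg⟩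
    exact (List.pairwise_append.1 hg.2).2.1.imp_of_mem fun hq hr h =>
      (IsEmbeddedAt.congr hgf' hq hr).1 h
  · rintro ⟨v, hvs, hpa, -, g, hgf, hg⟩
    have hgw : g w = v := (hgf List.mem_cons_self).trans (Function.update_self w v f)
    refine ⟨g, fun q hq => ?_, (isPlacement_cons G P).2 ⟨by rw [hgw]; exact ⟨hvs, hpa⟩, hg⟩⟩
    rw [hgf (List.mem_cons_of_mem w hq), Function.update_of_ne (ne_of_mem_of_not_mem hq hw)]

end Placement

section Completions

variable {V W : Type*} (G : SimpleGraph V) [DecidableRel G.Adj] (P : SimpleGraph W)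
  [DecidableRel P.Adj]

theorem candidates_mask (vs : List V) (f : W → V) (w : W) (placed : List W) (p : V → Bool) :
    candidates (placed.map fun q => decide (P.Adj w q)) ((placed.map f).map (trace G vs))
      (mask p vs) =
    mask (fun v => p v && placed.all fun q => decide (G.Adj (f q) v) == decide (P.Adj w q)) vs := by
  induction placed generalizing p with
  | nil => simp [candidates]
  | cons q placed ih =>
    refine Eq.trans ?_ ((ih fun v => p v && decide (G.Adj (f q) v) == decide (P.Adj w q)).trans ?_)
    · rw [← restrict_mask]
      rfl
    · simp only [List.all_cons, Bool.and_assoc]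

variable [DecidableEq V]

theorem testBit_union (f : Row → ℕ) {us vs : List V} (p : V → Bool)
    (hp : ∀ v ∈ vs, p v → v ∈ us) (hus : us ⊆ vs) (i : ℕ) :
    (union f (us.map (row G vs)) (mask p vs)).testBit i ↔
      ∃ v ∈ vs, p v ∧ (f (row G vs v)).testBit i := by
  induction us generalizing p with
  | nil => simpa [union] using fun v hv hpv => absurd (hp v hv hpv) List.not_mem_nil
  | cons u us ih =>
    have hsub : us ⊆ vs := (List.cons_subset.1 hus).2
    have hempty := beq_mask_zero (p := p) (vs := vs)
    have hdisj : disjoint (mask p vs) (row G vs u).bit = true ↔ p u = false := by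
      rw [row, disjoint_mask]
      grind
    have hrest := ih (fun v => p v && !decide (v = u)) (by grind) hsub
    change (bif Nat.beq (mask p vs) 0 then 0 else bif disjoint (mask p vs) (row G vs u).bit
      then union f (us.map (row G vs)) (mask p vs) else f (row G vs u) |||
        union f (us.map (row G vs)) (diff (mask p vs) (row G vs u).bit)).testBit i ↔ _
    cases hz : Nat.beq (mask p vs) 0
    · cases hd : disjoint (mask p vs) (row G vs u).bit
      · rw [← diff_mask] at hrest
        rw [cond_false, cond_false, Nat.testBit_or, Bool.or_eq_true]
        exact (or_congr_right hrest).trans (by grind)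
      · exact ih p (by grind) hsub
    · simp only [cond_true, Nat.zero_testBit]
      grind

variable {P} in
theorem testBit_completions_cons {vs : List V} {a : W → Bool} {p : V → Bool} {w : W}
    {ws placed : List W} {f : W → V} {A : ℕ} (hA : A ≠ 0) :
    (completions (code G vs) (pattern P a (w :: ws) placed) ((placed.map f).map (trace G vs))
      (mask (fun v => decide (v ∉ placed.map f)) vs) A).testBit (mask p vs) ↔
    ∃ v ∈ vs, (v ∉ placed.map f ∧ ∀ q ∈ placed, G.Adj (f q) v ↔ P.Adj w q) ∧
      (completions (code G vs) (pattern P a ws (w :: placed))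
        ((v :: placed.map f).map (trace G vs))
        (mask (fun u => decide (u ∉ v :: placed.map f)) vs)
        (restrict (a w) (truthTable v vs) A)).testBit (mask p vs) := by
  have hfree (v : V) : mask (fun u => decide (u ∉ v :: placed.map f)) vs =
      diff (mask (fun u => decide (u ∉ placed.map f)) vs) (row G vs v).bit := by
    rw [row, diff_mask, mask_eq_mask_iff]
    grind
  change (bif Nat.beq A 0 then 0 else union (fun r => completions (code G vs)
    (pattern P a ws (w :: placed)) (r.nbrs :: (placed.map f).map (trace G vs))
    (diff (mask (fun u => decide (u ∉ placed.map f)) vs) r.bit) (restrict (a w) r.table A))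
    (code G vs) (candidates (placed.map fun q => decide (P.Adj w q)) _ _)).testBit _ ↔ _
  rw [Bool.eq_false_iff.2 fun h => hA (Nat.eq_of_beq_eq_true h), cond_false, candidates_mask, code,
    testBit_union G _ _ (fun _ hv _ => hv) (List.Subset.refl _)]
  simp only [hfree, Bool.and_eq_true, decide_eq_true_eq, List.all_eq_true, beq_iff_eq, row,
    decide_eq_decide, List.map_cons]

theorem testBit_completions (vs : List V) (a : W → Bool) (p : V → Bool) {ws placed : List W}
    (hnodup : (ws.reverse ++ placed).Nodup) {f : W → V}
    (hf : placed.Pairwise (IsEmbeddedAt G P f)) (A : ℕ) :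
    (completions (code G vs) (pattern P a ws placed) ((placed.map f).map (trace G vs))
      (mask (fun v => decide (v ∉ placed.map f)) vs) A).testBit (mask p vs) ↔
    A.testBit (mask p vs) ∧
      ∃ g, Set.EqOn g f {w | w ∈ placed} ∧ IsPlacement G P vs a p ws placed g := by
  classical
  induction ws generalizing placed f A with
  | nil => exact (and_iff_left ⟨f, fun _ _ => rfl, by simp, hf⟩).symm
  | cons w ws ih =>
    rcases eq_or_ne A 0 with rfl | hA
    · simp [completions, pattern]
    rw [List.reverse_cons, List.append_assoc, List.singleton_append] at hnodup
    have hw : w ∉ placed := (List.nodup_cons.1 hnodup.of_append_right).1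
    have hmap (v : V) : (w :: placed).map (Function.update f w v) = v :: placed.map f := by
      rw [List.map_cons, Function.update_self]
      exact congrArg _ (List.map_congr_left fun q hq =>
        Function.update_of_ne (ne_of_mem_of_not_mem hq hw) v f)
    rw [testBit_completions_cons G hA, exists_isPlacement_cons hw, ← exists_and_left]
    refine exists_congr fun v => ?_
    rw [and_left_comm (a := A.testBit _)]
    refine and_congr_right fun hv => ?_
    rw [← pairwise_update_cons hw hf]
    have hnext (hf' : (w :: placed).Pairwise (IsEmbeddedAt G P (Function.update f w v))) :=
      ih hnodup hf' (restrict (a w) (truthTable v vs) A)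
    rw [hmap, testBit_restrict, testBit_truthTable hv, Bool.and_eq_true, beq_iff_eq] at hnext
    rw [and_congr_right hnext]
    tauto

end Completions

instance {n : ℕ} (adj : Fin n → List (Fin n)) : DecidableRel (ofAdjLists adj).Adj := fun i j =>
  inferInstanceAs (Decidable (i ≠ j ∧ (j ∈ adj i ∨ i ∈ adj j)))

/-- A graph given by adjacency lists, with an order in which its vertices are to be placed in
another graph. -/
structure Arrangement where
  /-- The number of vertices. -/
  size : ℕ
  /-- The adjacency lists. -/
  adj : Fin size → List (Fin size)
  /-- The order of the vertices. -/
  order : List (Fin size)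

namespace Arrangement

/-- The underlying graph. -/
abbrev graph (X : Arrangement) : SimpleGraph (Fin X.size) := ofAdjLists X.adj

/-- The order is an enumeration of the vertices. -/
abbrev IsValid (X : Arrangement) : Prop := X.order.Nodup ∧ ∀ i, i ∈ X.order

/-- The pattern of the graph with the first vertex of the order as the distinguished one, where the
second one is already placed. The sign tells whether these two are adjacent. There is no such
pattern if the graph has fewer than two vertices. -/
def rootedPatterns (X : Arrangement) : List (Bool × Pattern) :=
  match X.order with
  | root :: first :: rest => [(decide (X.graph.Adj root first),
      pattern X.graph (fun i => decide (X.graph.Adj root i)) rest [first])]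
  | _ => []

end Arrangement

/-- Is the graph in the list of rows as an induced subgraph? -/
def contains (h : List Row) (X : Arrangement) : Bool :=
  (completions h (pattern X.graph (fun _ => false) X.order []) [] (2 ^ h.length - 1) 1).testBit 0

/-- Discards those traces in `A` for which a new vertex would complete a copy of one of the given
patterns that contains the head of the list of rows. -/
def prune (F : List (Bool × Pattern)) : List Row → ℕ → ℕ
  | [], A => A
  | r :: h, A => F.foldl (fun A P => diff A
      (completions (r :: h) P.2 [r.nbrs] (r.bit - 1) (restrict P.1 r.table A))) A

section Contains

variable {V : Type*} [DecidableEq V] (G : SimpleGraph V) [DecidableRel G.Adj] {X : Arrangement}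

theorem contains_iff [Nonempty (Fin X.size → V)] (hX : X.IsValid) (vs : List V) :
    contains (code G vs) X ↔ ∃ f : Fin X.size → V, (∀ i, f i ∈ vs) ∧
      X.order.reverse.Pairwise (IsEmbeddedAt G X.graph f) := by
  obtain ⟨f⟩ := ‹Nonempty (Fin X.size → V)›
  have h := testBit_completions G X.graph vs (fun _ => false) (fun _ => false)
    (ws := X.order) (placed := []) (by simpa using hX.1) (f := f) .nil 1
  simpa only [mask_true, mask_false, IsPlacement, hX.2, List.append_nil, Set.EqOn, contains, code,
    List.length_map, List.map_nil, List.not_mem_nil, not_false_eq_true, decide_true,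
    Nat.testBit_one_zero, true_and, forall_const, and_true, Set.mem_ofPred_eq, false_imp_iff,
    implies_true] using h

theorem isIndContained_of_contains [Nonempty V] (hX : X.IsValid) {vs : List V}
    (h : contains (code G vs) X) : X.graph.IsIndContained G := by
  obtain ⟨f, -, hf⟩ := (contains_iff G hX vs).1 h
  exact isIndContained_of_pairwise (fun i => List.mem_reverse.2 (hX.2 i)) hf

theorem contains_of_isIndContained (hX : X.IsValid) {vs : List V} (hvs : ∀ v, v ∈ vs)
    (h : X.graph.IsIndContained G) : contains (code G vs) X := by
  obtain ⟨e⟩ := h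
  have : Nonempty (Fin X.size → V) := ⟨e⟩
  refine (contains_iff G hX vs).2 ⟨e, fun i => hvs _, (List.nodup_reverse.2 hX.1).imp fun hij => ?_⟩
  exact ⟨fun h => hij (e.injective h), e.map_adj_iff⟩

theorem row_bit_sub_one {v : V} {vs : List V} (hv : v ∉ vs) :
    (row G (v :: vs) v).bit - 1 = mask (fun u => decide (u ∉ [v])) (v :: vs) := by
  have hold : mask (fun u => decide (u = v)) vs = mask (fun _ => false) vs :=
    mask_eq_mask_iff.2 (by grind)
  have hnew : mask (fun u => decide (u ∉ [v])) vs = mask (fun _ => true) vs :=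
    mask_eq_mask_iff.2 (by grind)
  rw [row, mask_cons_of_true (by simp), mask_cons_of_false (by simp), hold, hnew, mask_false,
    mask_true, Nat.add_zero]

theorem isIndContained_of_testBit_completions (hX : X.IsValid) {P : Bool × Pattern}
    (hP : P ∈ X.rootedPatterns) {v x : V} {vs : List V} (hv : v ∉ vs) (hx : x ∉ v :: vs) {A : ℕ}
    (h : (completions (code G (v :: vs)) P.2 [trace G (v :: vs) v] ((row G (v :: vs) v).bit - 1)
      (restrict P.1 (truthTable v (v :: vs)) A)).testBit (trace G (v :: vs) x)) :
    X.graph.IsIndContained G := by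
  obtain ⟨hnodup, hmem⟩ := hX
  rw [Arrangement.rootedPatterns] at hP
  split at hP
  case h_2 => simp at hP
  case h_1 root first rest horder =>
  obtain rfl := List.mem_singleton.1 hP
  rw [horder] at hnodup hmem
  obtain ⟨hroot, hnodup⟩ := List.nodup_cons.1 hnodup
  have hreverse : rest.reverse ++ [first] = (first :: rest).reverse := by simp
  rw [row_bit_sub_one G hv] at h
  obtain ⟨hA, g, hgv, hg, hpair⟩ := (testBit_completions G X.graph (v :: vs) _
    (fun u => decide (G.Adj x u)) (placed := [first]) (f := fun _ => v)
    (hreverse ▸ List.nodup_reverse.2 hnodup) (List.pairwise_singleton _ _) _).1 h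
  rw [testBit_restrict, testBit_truthTable List.mem_cons_self] at hA
  have hplaced : ∀ i ∈ first :: rest, g i ∈ v :: vs ∧ (G.Adj x (g i) ↔ X.graph.Adj root i) := by
    refine List.forall_mem_cons.2 ⟨?_, fun i hi => by simpa using hg i hi⟩
    rw [hgv List.mem_cons_self]
    exact ⟨List.mem_cons_self, by simpa using (Bool.and_eq_true_iff.1 hA).2⟩
  rw [hreverse] at hpair
  refine isIndContained_of_pairwise (ws := root :: (first :: rest).reverse)
    (fun i => by simpa only [List.mem_cons, List.mem_reverse] using hmem i)
    ((pairwise_update_cons (mt List.mem_reverse.1 hroot) hpair x).2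
      ⟨fun hxg => ?_, fun i hi => ?_⟩)
  · obtain ⟨i, hi, rfl⟩ := List.mem_map.1 hxg
    exact hx (hplaced i (List.mem_reverse.1 hi)).1
  · rw [G.adj_comm]
    exact (hplaced i (List.mem_reverse.1 hi)).2

theorem testBit_trace_prune {F : List Arrangement} (hF : ∀ X ∈ F, X.IsValid)
    (hfree : ∀ X ∈ F, IsFree X.graph G) {v x : V} {vs : List V} (hv : v ∉ vs)
    (hx : x ∉ v :: vs) {A : ℕ} (hA : A.testBit (trace G (v :: vs) x)) :
    (prune (F.flatMap Arrangement.rootedPatterns) (code G (v :: vs)) A).testBit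
      (trace G (v :: vs) x) := by
  have hpatterns : ∀ P ∈ F.flatMap Arrangement.rootedPatterns, ∀ A,
      ¬ (completions (code G (v :: vs)) P.2 [trace G (v :: vs) v] ((row G (v :: vs) v).bit - 1)
      (restrict P.1 (truthTable v (v :: vs)) A)).testBit (trace G (v :: vs) x) := by
    intro P hP A h
    obtain ⟨X, hX, hPX⟩ := List.mem_flatMap.1 hP
    exact hfree X hX (isIndContained_of_testBit_completions G (hF X hX) hPX hv hx h)
  generalize F.flatMap Arrangement.rootedPatterns = Ps at hpatterns
  induction Ps generalizing A with
  | nil => exact hA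
  | cons P Ps ih =>
    rw [List.forall_mem_cons] at hpatterns
    refine ih ?_ hpatterns.2
    rw [testBit_diff, hA, Bool.true_and, Bool.not_eq_true']
    exact Bool.eq_false_iff.2 (hpatterns.1 A)

end Contains

/-! ### Colourings -/

/-- All ways of adding the vertex of `r` to one of the given colour classes that contains none of
its neighbours. -/
def joins (r : Row) : List ℕ → List (List ℕ)
  | [] => []
  | c :: cs => (bif disjoint r.nbrs c then [Nat.lor c r.bit :: cs] else []) ++
      (joins r cs).map (List.cons c)

/-- The partitions into at most `k` nonempty independent sets, as lists of masks. -/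
def colorings (k : ℕ) : List Row → List (List ℕ)
  | [] => [[]]
  | r :: h => (colorings k h).flatMap fun cs =>
      joins r cs ++ bif Nat.blt cs.length k then [r.bit :: cs] else []

/-- The map `f` is a proper colouring of the subgraph induced on `us`. -/
def IsColoringOn {V : Type*} (G : SimpleGraph V) {k : ℕ} (us : List V) (f : V → Fin k) : Prop :=
  ∀ u ∈ us, ∀ v ∈ us, G.Adj u v → f u ≠ f v

theorem exists_isColoringOn_iff {V : Type*} {G : SimpleGraph V} {k : ℕ} [NeZero k] {vs : List V} :
    (∃ f : V → Fin k, IsColoringOn G vs f) ↔ (G.induce {v | v ∈ vs}).Colorable k := by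
  classical
  constructor
  · rintro ⟨f, hf⟩
    exact ⟨.mk (fun v => f v) fun {u v} h => hf u u.2 v v.2 h⟩
  · rintro ⟨C⟩
    refine ⟨fun v => if hv : v ∈ vs then C ⟨v, hv⟩ else 0, fun u hu v hv h => ?_⟩
    simpa only [dif_pos hu, dif_pos hv] using C.valid (v := ⟨u, hu⟩) (w := ⟨v, hv⟩) h

section Colorings

variable {V : Type*} [DecidableEq V] (G : SimpleGraph V) [DecidableRel G.Adj] {k : ℕ}

theorem mem_joins {ι : Type*} [DecidableEq ι] {r : Row} {F : ι → ℕ} {is : List ι} (his : is.Nodup)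
    (cs : List ℕ) : cs ∈ joins r (is.map F) ↔ ∃ i ∈ is, disjoint r.nbrs (F i) ∧
      cs = is.map (Function.update F i (Nat.lor (F i) r.bit)) := by
  induction is generalizing cs with
  | nil => simp [joins]
  | cons j is ih =>
    obtain ⟨hj, his⟩ := List.nodup_cons.1 his
    have hhead (c : ℕ) : (j :: is).map (Function.update F j c) = c :: is.map F := by
      rw [List.map_cons, Function.update_self, List.map_congr_left fun i hi =>
        Function.update_of_ne (ne_of_mem_of_not_mem hi hj) c F]
    have htail {i : ι} (hi : i ∈ is) (c : ℕ) :
        (j :: is).map (Function.update F i c) = F j :: is.map (Function.update F i c) := by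
      rw [List.map_cons, Function.update_of_ne (ne_of_mem_of_not_mem hi hj).symm]
    have hjoin : (cs ∈ bif disjoint r.nbrs (F j) then [Nat.lor (F j) r.bit :: is.map F] else []) ↔
        disjoint r.nbrs (F j) ∧ cs = Nat.lor (F j) r.bit :: is.map F := by
      cases disjoint r.nbrs (F j) <;> simp
    rw [List.map_cons, joins, List.mem_append, hjoin, List.exists_mem_cons_iff, hhead]
    refine or_congr_right ?_
    simp only [List.mem_map, ih his]
    exact ⟨by rintro ⟨_, ⟨i, hi, hd, rfl⟩, rfl⟩; exact ⟨i, hi, hd, (htail hi _).symm⟩,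
      by rintro ⟨i, hi, hd, rfl⟩; exact ⟨_, ⟨i, hi, hd, rfl⟩, (htail hi _).symm⟩⟩

/-- The mask of the vertices of `us` that `f` colours with `i`. -/
def colorClass (vs us : List V) (f : V → Fin k) (i : Fin k) : ℕ :=
  mask (fun v => decide (v ∈ us ∧ f v = i)) vs

theorem colorClass_cons {u : V} {us : List V} (hu : u ∉ us) (vs : List V) (f : V → Fin k)
    (i : Fin k) : colorClass vs (u :: us) (Function.update f u i) =
      Function.update (colorClass vs us f) i
        (Nat.lor (colorClass vs us f i) (row G vs u).bit) := by
  funext j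
  rcases eq_or_ne j i with rfl | hji
  · rw [Function.update_self, row, colorClass, colorClass, mask_lor, mask_eq_mask_iff]
    grind
  · rw [Function.update_of_ne hji, colorClass, colorClass, mask_eq_mask_iff]
    grind

theorem disjoint_colorClass {u : V} {us vs : List V} (hus : us ⊆ vs) {f : V → Fin k} {i : Fin k} :
    disjoint (row G vs u).nbrs (colorClass vs us f i) ↔ ∀ v ∈ us, G.Adj u v → f v ≠ i := by
  rw [row, trace, colorClass, disjoint_mask]
  grind

theorem exists_notMem_iff_length_lt {is : List (Fin k)} (his : is.Nodup) :
    (∃ i, i ∉ is) ↔ is.length < k := by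
  have hcard := Finset.card_lt_iff_ne_univ is.toFinset
  rw [List.toFinset_card_of_nodup his, Fintype.card_fin] at hcard
  simp only [hcard, ne_eq, Finset.eq_univ_iff_forall, List.mem_toFinset, not_forall]

theorem map_colorClass_cons {u : V} {us : List V} (hu : u ∉ us) (vs : List V) {f : V → Fin k}
    {i : Fin k} {is : List (Fin k)} (hi : i ∉ is) (hf : ∀ v ∈ us, f v ∈ is) :
    (i :: is).map (colorClass vs (u :: us) (Function.update f u i)) =
      (row G vs u).bit :: is.map (colorClass vs us f) := by
  have hempty : colorClass vs us f i = mask (fun _ => false) vs :=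
    mask_eq_mask_iff.2 (by grind)
  rw [List.map_cons, colorClass_cons G hu, Function.update_self, hempty, mask_false,
    List.map_congr_left fun j hj => Function.update_of_ne (ne_of_mem_of_not_mem hj hi) _ _]
  congr 1
  exact Nat.zero_or _

theorem mem_colorings_cons {u : V} {us vs : List V} (hu : u ∉ us) (hus : us ⊆ vs) {f : V → Fin k}
    {is : List (Fin k)} (his : is.Nodup) (hf : ∀ v ∈ us, f v ∈ is) (cs : List ℕ) :
    (cs ∈ joins (row G vs u) (is.map (colorClass vs us f)) ++
      bif Nat.blt (is.map (colorClass vs us f)).length k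
        then [(row G vs u).bit :: is.map (colorClass vs us f)] else []) ↔
    ∃ i, (∀ v ∈ us, G.Adj u v → f v ≠ i) ∧
      cs = (is.insert i).map (colorClass vs (u :: us) (Function.update f u i)) := by
  have hnew : (cs ∈ bif Nat.blt (is.map (colorClass vs us f)).length k
        then [(row G vs u).bit :: is.map (colorClass vs us f)] else []) ↔
      ∃ i, i ∉ is ∧ cs = (row G vs u).bit :: is.map (colorClass vs us f) := by
    rw [exists_and_right, exists_notMem_iff_length_lt his, List.length_map, ← Nat.blt_eq]
    cases Nat.blt is.length k <;> simp
  rw [List.mem_append, hnew, mem_joins his, ← exists_or]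
  refine exists_congr fun i => ?_
  rw [disjoint_colorClass G hus, ← colorClass_cons G hu]
  by_cases hi : i ∈ is
  · simp [hi]
  · have hfree : ∀ v ∈ us, G.Adj u v → f v ≠ i := fun v hv _ h => hi (h ▸ hf v hv)
    rw [List.insert_of_not_mem hi, map_colorClass_cons G hu vs hi hf]
    simp only [hi, false_and, false_or, not_false_eq_true, true_and]
    exact (and_iff_right hfree).symm

theorem exists_isColoringOn_of_mem_colorings [NeZero k] {us vs : List V} (hus : us.Nodup)
    (hsub : us ⊆ vs) {cs : List ℕ} (hcs : cs ∈ colorings k (us.map (row G vs))) :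
    ∃ (f : V → Fin k) (is : List (Fin k)), IsColoringOn G us f ∧ is.Nodup ∧
      (∀ v ∈ us, f v ∈ is) ∧ cs = is.map (colorClass vs us f) := by
  induction us generalizing cs with
  | nil => exact ⟨0, [], by simp [IsColoringOn], .nil, by simp, by simpa [colorings] using hcs⟩
  | cons u us ih =>
    obtain ⟨hu, hus⟩ := List.nodup_cons.1 hus
    have hsub := (List.cons_subset.1 hsub).2
    obtain ⟨_, hcs', hcs⟩ := List.mem_flatMap.1 hcs
    obtain ⟨f, is, hf, his, hmem, rfl⟩ := ih hus hsub hcs'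
    obtain ⟨i, hi, rfl⟩ := (mem_colorings_cons G hu hsub his hmem _).1 hcs
    refine ⟨Function.update f u i, is.insert i, ?_, his.insert, by grind, rfl⟩
    intro v hv w hw hvw
    grind [IsColoringOn, G.adj_comm, G.irrefl]

theorem exists_mem_colorings {us vs : List V} (hus : us.Nodup) (hsub : us ⊆ vs) {f : V → Fin k}
    (hf : IsColoringOn G us f) : ∃ is : List (Fin k), is.Nodup ∧ (∀ v ∈ us, f v ∈ is) ∧
      is.map (colorClass vs us f) ∈ colorings k (us.map (row G vs)) := by
  induction us with
  | nil => exact ⟨[], .nil, by simp, by simp [colorings]⟩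
  | cons u us ih =>
    obtain ⟨hu, hus⟩ := List.nodup_cons.1 hus
    have hsub := (List.cons_subset.1 hsub).2
    obtain ⟨is, his, hmem, hcs⟩ := ih hus hsub fun v hv w hw => hf v (by simp [hv]) w (by simp [hw])
    refine ⟨is.insert (f u), his.insert, by grind, List.mem_flatMap.2 ⟨_, hcs, ?_⟩⟩
    refine (mem_colorings_cons G hu hsub his hmem _).2 ⟨f u, fun v hv h => ?_, ?_⟩
    · exact (hf u (by simp) v (by simp [hv]) h).symm
    · rw [Function.update_eq_self]

theorem colorings_ne_nil_iff [NeZero k] {vs : List V} (hvs : vs.Nodup) :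
    (colorings k (code G vs)) ≠ [] ↔ (G.induce {v | v ∈ vs}).Colorable k := by
  rw [← exists_isColoringOn_iff]
  constructor
  · intro h
    obtain ⟨cs, hcs⟩ := List.exists_mem_of_ne_nil _ h
    obtain ⟨f, -, hf, -⟩ := exists_isColoringOn_of_mem_colorings G hvs (List.Subset.refl _) hcs
    exact ⟨f, hf⟩
  · rintro ⟨f, hf⟩
    obtain ⟨is, -, -, h⟩ := exists_mem_colorings G hvs (List.Subset.refl _) hf
    exact List.ne_nil_of_mem h

end Colorings

/-! ### Foldings -/

/-- A partial self-map of a graph, as the list of pairs of a vertex and its image. -/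
abbrev Folding : Type := List (Row × Row)

/-- The mask of a list of vertices. -/
def support (us : List Row) : ℕ := us.foldr (fun u => Nat.lor u.bit) 0

/-- Together with the identity elsewhere, the map is an endomorphism of the graph that misses its
sources. -/
def isEndomorphism (m : Folding) : Bool :=
  let S := support (m.map Prod.fst)
  m.all fun x => disjoint x.2.bit S && submask x.1.nbrs (Nat.lor x.2.nbrs S) &&
    m.all fun y => disjoint x.1.nbrs y.1.bit || !disjoint x.2.nbrs y.2.bit

/-- The vertices outside the mask `S` that are adjacent to all neighbours of `u` outside `S`. -/
def covers (h : List Row) (S : ℕ) (u : Row) : List Row :=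
  h.filter fun v => submask u.nbrs (Nat.lor v.nbrs S) && disjoint S v.bit

/-- The endomorphisms that move the vertices `us`, and no others, away from `us`. -/
def foldings (h us : List Row) : List Folding :=
  let S := support us
  (us.foldr (fun u ms => (covers h S u).flatMap fun v => ms.map (List.cons (u, v)))
    [[]]).filter isEndomorphism

/-- The endomorphisms that move a single vertex. -/
def vertexFoldings (h : List Row) : List Folding := h.flatMap fun u => foldings h [u]

/-- The endomorphisms that move the two ends of an edge. -/
def edgeFoldings (h : List Row) : List Folding :=
  h.flatMap fun a => h.flatMap fun b =>
    bif Nat.blt a.bit b.bit && !disjoint a.nbrs b.bit then foldings h [a, b] else []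

/-- The traces in `A` of new vertices that keep `m` from extending to an endomorphism. -/
def blockers (A : ℕ) (m : Folding) : ℕ :=
  m.foldr (fun x => Nat.lor (diff (Nat.land A x.1.table) x.2.table)) 0

/-- The smaller of two numbers. A smaller set of masks in the order of numbers is not always a
subset, but it has a smaller highest element. -/
def smaller (a b : ℕ) : ℕ := bif Nat.ble a b then a else b

/-- A subset of the set `A` of the traces of vertices outside a colourable part of a critical
graph, at least one of which occurs. -/
def obstruction (h : List Row) (A : ℕ) : ℕ :=
  let o := (vertexFoldings h).foldr (fun m => smaller (blockers A m)) (diff A 1)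
  bif Nat.beq o 0 then 0 else (edgeFoldings h).foldr (fun m => smaller (blockers A m)) o

theorem foldr_smaller_eq {ι : Type*} (f : ι → ℕ) (l : List ι) (a : ℕ) :
    l.foldr (fun i => smaller (f i)) a = a ∨
      ∃ i ∈ l, l.foldr (fun i => smaller (f i)) a = f i := by
  induction l with
  | nil => exact .inl rfl
  | cons i l ih =>
    rw [List.foldr_cons, smaller]
    cases Nat.ble (f i) _
    · exact ih.imp_right fun ⟨j, hj, h⟩ => ⟨j, .tail _ hj, h⟩
    · exact .inr ⟨i, .head _, rfl⟩

theorem obstruction_eq (h : List Row) (A : ℕ) : obstruction h A = diff A 1 ∨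
    ∃ m ∈ vertexFoldings h ++ edgeFoldings h, obstruction h A = blockers A m := by
  simp only [List.mem_append, or_and_right, exists_or, ← or_assoc]
  have hvertex := foldr_smaller_eq (blockers A) (vertexFoldings h) (diff A 1)
  rw [obstruction]
  cases hzero : Nat.beq _ 0
  · refine (foldr_smaller_eq (blockers A) (edgeFoldings h) _).imp_left fun hedge => ?_
    simpa only [cond_false, hedge] using hvertex
  · rw [cond_true, ← Nat.eq_of_beq_eq_true hzero]
    exact .inl hvertex

theorem mem_foldings {h us : List Row} {m : Folding} (hm : m ∈ foldings h us) :
    isEndomorphism m ∧ m.map Prod.fst = us ∧ m.map Prod.snd ⊆ h := by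
  rw [foldings, List.mem_filter] at hm
  obtain ⟨hm, hendo⟩ := hm
  refine ⟨hendo, ?_⟩
  clear hendo
  generalize support us = S at hm
  induction us generalizing m with
  | nil => simp_all
  | cons u us ih =>
    obtain ⟨v, hv, hm⟩ := List.mem_flatMap.1 hm
    obtain ⟨_, hrest, rfl⟩ := List.mem_map.1 hm
    obtain ⟨hfst, hsnd⟩ := ih hrest
    exact ⟨congrArg _ hfst, List.cons_subset.2 ⟨(List.mem_filter.1 hv).1, hsnd⟩⟩

theorem mem_vertexFoldings_append_edgeFoldings {h : List Row} {m : Folding}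
    (hm : m ∈ vertexFoldings h ++ edgeFoldings h) :
    isEndomorphism m ∧ m ≠ [] ∧ m.map Prod.fst ⊆ h ∧ m.map Prod.snd ⊆ h := by
  obtain ⟨us, hus, hne, hm⟩ : ∃ us ⊆ h, us ≠ [] ∧ m ∈ foldings h us := by
    rcases List.mem_append.1 hm with hm | hm
    · obtain ⟨u, hu, hm⟩ := List.mem_flatMap.1 hm
      exact ⟨[u], by simpa using hu, by simp, hm⟩
    · obtain ⟨a, ha, hm⟩ := List.mem_flatMap.1 hm
      obtain ⟨b, hb, hm⟩ := List.mem_flatMap.1 hm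
      refine ⟨[a, b], by simp [ha, hb], by simp, ?_⟩
      cases hab : Nat.blt a.bit b.bit && !disjoint a.nbrs b.bit <;> simp_all
  obtain ⟨hendo, rfl, hsnd⟩ := mem_foldings hm
  exact ⟨hendo, by simpa using hne, hus, hsnd⟩

section Foldings

variable {V : Type*} [DecidableEq V] (G : SimpleGraph V) [DecidableRel G.Adj] {vs : List V}

theorem support_map_row {us : List V} :
    support (us.map (row G vs)) = mask (fun v => decide (v ∈ us)) vs := by
  induction us with
  | nil => simp [support, mask_false]
  | cons u us ih =>
    change Nat.lor (row G vs u).bit (support (us.map (row G vs))) = _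
    rw [ih, row, mask_lor, mask_eq_mask_iff]
    simp

theorem isEndomorphism_map {ps : List (V × V)} (hps : ∀ x ∈ ps, x.1 ∈ vs ∧ x.2 ∈ vs) :
    isEndomorphism (ps.map (Prod.map (row G vs) (row G vs))) ↔ ∀ x ∈ ps,
      x.2 ∉ ps.map Prod.fst ∧
      (∀ v ∈ vs, G.Adj x.1 v → G.Adj x.2 v ∨ v ∈ ps.map Prod.fst) ∧
      ∀ y ∈ ps, G.Adj x.1 y.1 → G.Adj x.2 y.2 := by
  have hfst : (ps.map (Prod.map (row G vs) (row G vs))).map Prod.fst =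
      (ps.map Prod.fst).map (row G vs) := by simp
  have hdisj {u v : V} (hv : v ∈ vs) :
      disjoint (row G vs u).nbrs (row G vs v).bit = !decide (G.Adj u v) := by
    rw [Bool.eq_iff_iff, row, row, trace, disjoint_mask]
    grind
  rw [isEndomorphism, hfst, support_map_row, List.all_map, List.all_eq_true]
  refine forall₂_congr fun x hx => ?_
  have himage : disjoint (row G vs x.2).bit (mask (fun v => decide (v ∈ ps.map Prod.fst)) vs) ↔
      x.2 ∉ ps.map Prod.fst := by
    rw [row, disjoint_mask]
    grind
  have hnbrs : submask (row G vs x.1).nbrs (Nat.lor (row G vs x.2).nbrs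
      (mask (fun v => decide (v ∈ ps.map Prod.fst)) vs)) ↔
      ∀ v ∈ vs, G.Adj x.1 v → G.Adj x.2 v ∨ v ∈ ps.map Prod.fst := by
    simp only [row, trace, mask_lor, submask_mask, Bool.or_eq_true, decide_eq_true_eq]
  simp only [Function.comp_apply, Prod.map_fst, Prod.map_snd, Bool.and_eq_true, himage, hnbrs,
    and_assoc, List.all_map, List.all_eq_true]
  refine and_congr_right fun _ => and_congr_right fun _ => forall₂_congr fun y hy => ?_
  rw [hdisj (hps y hy).1, hdisj (hps y hy).2, Bool.not_not, Bool.or_eq_true, Bool.not_eq_true',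
    decide_eq_false_iff_not, decide_eq_true_eq, imp_iff_not_or]

theorem testBit_blockers_map {ps : List (V × V)} (hps : ∀ x ∈ ps, x.1 ∈ vs ∧ x.2 ∈ vs) {A : ℕ}
    {x : V} (hx : A.testBit (trace G vs x)) :
    (blockers A (ps.map (Prod.map (row G vs) (row G vs)))).testBit (trace G vs x) ↔
      ∃ q ∈ ps, G.Adj x q.1 ∧ ¬ G.Adj x q.2 := by
  induction ps with
  | nil => simp [blockers]
  | cons q ps ih =>
    obtain ⟨⟨hfst, hsnd⟩, hps⟩ := List.forall_mem_cons.1 hps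
    change (diff (A &&& truthTable q.1 vs) (truthTable q.2 vs) |||
      blockers A (ps.map (Prod.map (row G vs) (row G vs)))).testBit (trace G vs x) ↔ _
    rw [Nat.testBit_or, Bool.or_eq_true, ih hps, List.exists_mem_cons_iff, testBit_diff,
      Nat.testBit_and, hx, trace, testBit_truthTable hfst, testBit_truthTable hsnd]
    simp

theorem exists_map_row {m : Folding} (hfst : m.map Prod.fst ⊆ code G vs)
    (hsnd : m.map Prod.snd ⊆ code G vs) : ∃ ps : List (V × V),
      (∀ x ∈ ps, x.1 ∈ vs ∧ x.2 ∈ vs) ∧ ps.map (Prod.map (row G vs) (row G vs)) = m := by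
  induction m with
  | nil => exact ⟨[], by simp⟩
  | cons x m ih =>
    obtain ⟨hx₁, hfst⟩ := List.cons_subset.1 hfst
    obtain ⟨hx₂, hsnd⟩ := List.cons_subset.1 hsnd
    obtain ⟨u, hu, hux⟩ := List.mem_map.1 hx₁
    obtain ⟨v, hv, hvx⟩ := List.mem_map.1 hx₂
    obtain ⟨ps, hps, rfl⟩ := ih hfst hsnd
    exact ⟨(u, v) :: ps, List.forall_mem_cons.2 ⟨⟨hu, hv⟩, hps⟩, by simp [hux, hvx]⟩

end Foldings

section Obstruction

variable {V : Type*} {G : SimpleGraph V} {k : ℕ} {vs : List V}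

/-- Otherwise the pairs extend to an endomorphism of `G` by the identity, and its image misses the
sources. -/
theorem IsVertexCritical.exists_blocker (hG : IsVertexCritical G (k + 1)) {ps : List (V × V)}
    (hne : ps ≠ []) (hmissed : ∀ x ∈ ps, x.2 ∉ ps.map Prod.fst)
    (hnbrs : ∀ x ∈ ps, ∀ v ∈ vs, G.Adj x.1 v → G.Adj x.2 v ∨ v ∈ ps.map Prod.fst)
    (hedges : ∀ x ∈ ps, ∀ y ∈ ps, G.Adj x.1 y.1 → G.Adj x.2 y.2) :
    ∃ x ∉ vs, ∃ q ∈ ps, G.Adj x q.1 ∧ ¬ G.Adj x q.2 := by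
  by_contra! hblock
  have hvalue (x : V) : ∃ y, (x, y) ∈ ps ∨ (y = x ∧ x ∉ ps.map Prod.fst) := by
    by_cases hx : x ∈ ps.map Prod.fst
    · obtain ⟨q, hq, rfl⟩ := List.mem_map.1 hx
      exact ⟨q.2, .inl hq⟩
    · exact ⟨x, .inr ⟨rfl, hx⟩⟩
  choose φ hφ using hvalue
  have hmove {x y : V} (hx : (x, φ x) ∈ ps) (hy : y ∉ ps.map Prod.fst) (hxy : G.Adj x y) :
      G.Adj (φ x) y := by
    by_cases hyvs : y ∈ vs
    · exact (hnbrs _ hx y hyvs hxy).resolve_right hy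
    · exact (hblock y hyvs _ hx hxy.symm).symm
  have hhom {x y : V} (hxy : G.Adj x y) : G.Adj (φ x) (φ y) := by
    rcases hφ x with hx | ⟨hx, hxfst⟩ <;> rcases hφ y with hy | ⟨hy, hyfst⟩
    · exact hedges _ hx _ hy hxy
    · exact hy.symm ▸ hmove hx hyfst hxy
    · exact hx.symm ▸ (hmove hy hxfst hxy.symm).symm
    · rwa [hx, hy]
  obtain ⟨q, hq⟩ := List.exists_mem_of_ne_nil ps hne
  have hsource : q.1 ∈ ps.map Prod.fst := List.mem_map_of_mem hq
  obtain ⟨x, hx⟩ := hG.surjective_hom (isVertexCritical_succ_iff.1 hG).1 ⟨φ, hhom⟩ q.1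
  change φ x = q.1 at hx
  rcases hφ x with hmem | ⟨hfix, hfst⟩
  · exact hmissed _ hmem (hx ▸ hsource)
  · exact hfst (hfix ▸ hx ▸ hsource)

theorem IsVertexCritical.exists_testBit_obstruction [DecidableEq V] [DecidableRel G.Adj]
    (hG : IsVertexCritical G (k + 1)) (hne : vs ≠ [])
    (hcol : (G.induce {v | v ∈ vs}).Colorable k) {A : ℕ}
    (hA : ∀ x ∉ vs, A.testBit (trace G vs x)) :
    ∃ x ∉ vs, (obstruction (code G vs) A).testBit (trace G vs x) := by
  rcases obstruction_eq (code G vs) A with h | ⟨m, hm, h⟩ <;> rw [h]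
  · obtain ⟨v, hv⟩ := List.exists_mem_of_ne_nil vs hne
    obtain ⟨x, hx, y, hy, hxy⟩ := hG.exists_adj_outside (s := {v | v ∈ vs}) ⟨v, hv⟩ hcol
    refine ⟨x, hx, ?_⟩
    have htrace : trace G vs x ≠ 0 := fun hzero => by
      rw [trace, ← mask_false vs, mask_eq_mask_iff] at hzero
      exact absurd (hzero y hy) (by simpa using hxy)
    rw [testBit_diff, hA x hx, Bool.true_and, Bool.not_eq_true', Bool.eq_false_iff]
    exact mt Nat.testBit_one_eq_true_iff_self_eq_zero.1 htrace
  · obtain ⟨hendo, hmne, hfst, hsnd⟩ := mem_vertexFoldings_append_edgeFoldings hm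
    obtain ⟨ps, hps, rfl⟩ := exists_map_row G hfst hsnd
    have hpsne : ps ≠ [] := by rintro rfl; exact hmne rfl
    rw [isEndomorphism_map G hps] at hendo
    obtain ⟨x, hx, hq⟩ := hG.exists_blocker hpsne (fun x hx => (hendo x hx).1)
      (fun x hx => (hendo x hx).2.1) (fun x hx => (hendo x hx).2.2)
    exact ⟨x, hx, (testBit_blockers_map G hps (hA x hx)).2 hq⟩

end Obstruction

/-! ### The search -/

/-- Does every `k + 1`-vertex-critical graph that avoids the rooted patterns `F` and extends the
list of rows `h` by vertices with traces in `A` contain a graph from `T`? While the list of rows is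
`k`-colourable, the search branches on whether the highest trace of an obstruction occurs. The first
number bounds the depth. -/
def search (k : ℕ) (F : List (Bool × Pattern)) (T : List Arrangement) :
    ℕ → List Row → ℕ → Bool
  | 0, _, _ => false
  | n + 1, h, A =>
    bif (colorings k h).isEmpty then T.any (contains h) else
      let o := obstruction h A
      bif Nat.beq o 0 then true else
        let t := Nat.log2 o
        let h' := extend h t
        search k F T n h' (prune F h' (double (Nat.pow 2 h.length) A)) &&
          search k F T n h (diff A (Nat.pow 2 t))

section Search

variable {V : Type*} [DecidableEq V] {G : SimpleGraph V} [DecidableRel G.Adj]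

theorem testBit_double_trace {v x : V} {vs : List V} {A : ℕ} (h : A.testBit (trace G vs x)) :
    (double (2 ^ (code G vs).length) A).testBit (trace G (v :: vs) x) := by
  have hdouble := testBit_double_of_testBit (2 ^ vs.length) h
  rw [code, List.length_map, trace]
  by_cases hadj : G.Adj x v
  · rw [mask_cons_of_true (by simpa using hadj)]
    exact hdouble.2
  · rw [mask_cons_of_false (by simpa using hadj)]
    exact hdouble.1

theorem IsVertexCritical.exists_isIndContained_of_search {k : ℕ} [NeZero k]
    (hG : IsVertexCritical G (k + 1)) {F T : List Arrangement} (hF : ∀ X ∈ F, X.IsValid)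
    (hT : ∀ X ∈ T, X.IsValid) (hfree : ∀ X ∈ F, IsFree X.graph G) {n : ℕ} {vs : List V}
    (hne : vs ≠ []) (hvs : vs.Nodup) {A : ℕ} (hA : ∀ x ∉ vs, A.testBit (trace G vs x))
    (h : search k (F.flatMap Arrangement.rootedPatterns) T n (code G vs) A) :
    ∃ X ∈ T, X.graph.IsIndContained G := by
  induction n generalizing vs A with
  | zero => cases h
  | succ n ih =>
    rw [search] at h
    cases hcol : (colorings k (code G vs)).isEmpty <;> rw [hcol] at h
    case true =>
      obtain ⟨X, hX, hcontains⟩ := List.any_eq_true.1 h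
      have : Nonempty V := ⟨vs.head hne⟩
      exact ⟨X, hX, isIndContained_of_contains G (hT X hX) hcontains⟩
    case false =>
    rw [Bool.eq_false_iff, Ne, List.isEmpty_iff] at hcol
    obtain ⟨y, _, hobs⟩ :=
      hG.exists_testBit_obstruction hne ((colorings_ne_nil_iff G hvs).1 hcol) hA
    have ho : Nat.beq (obstruction (code G vs) A) 0 = false :=
      Bool.eq_false_iff.2 fun hzero => by simp [Nat.eq_of_beq_eq_true hzero] at hobs
    simp only [ho, cond_false, Bool.and_eq_true] at h
    generalize Nat.log2 _ = t at h
    by_cases hv : ∃ v ∉ vs, trace G vs v = t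
    · obtain ⟨v, hv, rfl⟩ := hv
      rw [← code_cons G hv] at h
      refine ih (List.cons_ne_nil v vs) (List.nodup_cons.2 ⟨hv, hvs⟩) (fun x hx => ?_) h.1
      exact testBit_trace_prune G hF hfree hv hx
        (testBit_double_trace (hA x (mt (List.mem_cons_of_mem v) hx)))
    · refine ih hne hvs (fun x hx => ?_) h.2
      change (diff A (2 ^ t)).testBit _
      rw [testBit_diff, hA x hx, Nat.testBit_two_pow]
      simpa using fun htrace => hv ⟨x, hx, htrace.symm⟩

end Search

/-- The initial set `3` consists of both traces `0` and `1` on a single vertex. -/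
theorem IsVertexCritical.exists_isIndContained {V : Type*} {G : SimpleGraph V} {k : ℕ}
    [NeZero k] (hG : IsVertexCritical G (k + 1)) {F T : List Arrangement} (hF : ∀ X ∈ F, X.IsValid)
    (hT : ∀ X ∈ T, X.IsValid) (hfree : ∀ X ∈ F, IsFree X.graph G) {n : ℕ}
    (h : search k (F.flatMap Arrangement.rootedPatterns) T n (extend [] 0) 3) :
    ∃ X ∈ T, X.graph.IsIndContained G := by
  classical
  obtain ⟨v⟩ : Nonempty V := by
    by_contra! hV
    exact (isVertexCritical_succ_iff.1 hG).1 (.of_isEmpty k)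
  have hcode : code G [v] = extend [] 0 := code_cons G (by simp)
  refine hG.exists_isIndContained_of_search hF hT hfree (List.cons_ne_nil v [])
    (List.nodup_singleton v) (fun x _ => ?_) (hcode ▸ h)
  exact (Nat.testBit_two_pow_sub_one 2 _).trans (decide_eq_true (mask_lt _ [v]))

/-! ### Certificates for classifications -/

namespace Arrangement

/-- Is the graph `k + 1`-vertex-critical? -/
def isCritical (k : ℕ) (X : Arrangement) : Bool :=
  (colorings k (code X.graph X.order)).isEmpty &&
    X.order.all fun v => !(colorings k (code X.graph (X.order.erase v))).isEmpty

/-- The graph on the standard vertex set. -/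
def finGraph (X : Arrangement) : FinGraph := ⟨X.size, X.graph⟩

theorem IsValid.isVertexCritical {X : Arrangement} (hX : X.IsValid) {k : ℕ} [NeZero k]
    (h : X.isCritical k) : IsVertexCritical X.graph (k + 1) := by
  rw [isCritical, Bool.and_eq_true, List.all_eq_true, List.isEmpty_iff] at h
  rw [isVertexCritical_succ_iff]
  constructor
  · intro hcol
    have hinduced : (X.graph.induce {v | v ∈ X.order}).Colorable k :=
      hcol.of_hom (SimpleGraph.Embedding.induce _).toHom
    exact (colorings_ne_nil_iff X.graph hX.1).2 hinduced h.1
  · intro v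
    have hdel : {w | w ∈ X.order.erase v} = {v}ᶜ := by
      ext w
      simp [hX.1.mem_erase_iff, hX.2 w]
    rw [← hdel, ← colorings_ne_nil_iff X.graph (hX.1.erase v)]
    simpa using h.2 v (hX.2 v)

theorem IsValid.isFree {X Y : Arrangement} (hX : X.IsValid) (hY : Y.IsValid)
    (h : contains (code Y.graph Y.order) X = false) : IsFree X.graph Y.graph := fun hXY =>
  Bool.eq_false_iff.1 h (contains_of_isIndContained Y.graph hX hY.2 hXY)

end Arrangement

/-- Evidence that the graphs `K` and `L` are the `k + 1`-vertex-critical graphs that avoid the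
graphs `F`: a critical graph other than `K` does not contain `K`, so `K` joins the forbidden graphs
in the search. The search depth `100` is never attained. -/
structure Certificate (k : ℕ) (F : List Arrangement) (K : Arrangement) (L : List Arrangement) :
    Prop where
  isValid_forbidden : ∀ X ∈ F, X.IsValid
  isValid : ∀ Y ∈ K :: L, Y.IsValid
  isCritical : ∀ Y ∈ K :: L, Y.isCritical k
  contains_eq_false : ∀ Y ∈ K :: L, ∀ X ∈ F, contains (code Y.graph Y.order) X = false
  pairwise : (K :: L).Pairwise fun X Y => contains (code Y.graph Y.order) X = false
  exhaustive : search k ((K :: F).flatMap Arrangement.rootedPatterns) L 100 (extend [] 0) 3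

namespace Certificate

variable {k : ℕ} {F L : List Arrangement} {K : Arrangement}

theorem isVertexCritical [NeZero k] (h : Certificate k F K L) {Y : Arrangement} (hY : Y ∈ K :: L) :
    IsVertexCritical Y.graph (k + 1) :=
  (h.isValid Y hY).isVertexCritical (h.isCritical Y hY)

theorem exists_isIndContained [NeZero k] (h : Certificate k F K L) {V : Type*}
    {G : SimpleGraph V} (hG : IsVertexCritical G (k + 1)) (hfree : ∀ X ∈ F, IsFree X.graph G) :
    ∃ Y ∈ K :: L, Y.graph.IsIndContained G := by
  classical
  obtain ⟨hK, hL⟩ := List.forall_mem_cons.1 h.isValid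
  by_cases hKG : K.graph.IsIndContained G
  · exact ⟨K, List.mem_cons_self, hKG⟩
  · obtain ⟨Y, hY, hYG⟩ := hG.exists_isIndContained
      (List.forall_mem_cons.2 ⟨hK, h.isValid_forbidden⟩) hL
      (List.forall_mem_cons.2 ⟨hKG, hfree⟩) h.exhaustive
    exact ⟨Y, List.mem_cons_of_mem K hY, hYG⟩

theorem isVertexCritical_iff [NeZero k] (h : Certificate k F K L) {V : Type*} {G : SimpleGraph V} :
    (IsVertexCritical G (k + 1) ∧ ∀ X ∈ F, IsFree X.graph G) ↔
      ∃ H ∈ (K :: L).map Arrangement.finGraph, Nonempty (G ≃g H.2) := by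
  constructor
  · rintro ⟨hG, hfree⟩
    obtain ⟨Y, hY, hYG⟩ := h.exists_isIndContained hG hfree
    exact ⟨Y.finGraph, List.mem_map_of_mem hY,
      hG.nonempty_iso (isVertexCritical_succ_iff.1 (h.isVertexCritical hY)).1 hYG⟩
  · rintro ⟨_, hH, ⟨e⟩⟩
    obtain ⟨Y, hY, rfl⟩ := List.mem_map.1 hH
    exact ⟨(h.isVertexCritical hY).of_iso e, fun X hX => ((h.isValid_forbidden X hX).isFree
      (h.isValid Y hY) (h.contains_eq_false Y hY X hX)).of_iso e⟩

theorem pairwise_not_equiv (h : Certificate k F K L) :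
    ((K :: L).map Arrangement.finGraph).Pairwise (¬ · ≈ ·) := by
  refine List.pairwise_map.2 (h.pairwise.imp_of_mem fun hX hY hXY ⟨e⟩ => ?_)
  exact (h.isValid _ hX).isFree (h.isValid _ hY) hXY ⟨e.toEmbedding⟩

end Certificate

theorem encard_criticalClasses {W : Type*} {H : SimpleGraph W} {k : ℕ} {L : List FinGraph}
    (hL : ∀ G : FinGraph, (IsVertexCritical G.2 k ∧ IsFree P5 G.2 ∧ IsFree H G.2) ↔
      ∃ Y ∈ L, Nonempty (G.2 ≃g Y.2))
    (hpair : L.Pairwise (¬ · ≈ ·)) : (criticalClasses k H).encard = L.length := by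
  classical
  let classes : List (Quotient isoSetoid) := L.map (Quotient.mk isoSetoid)
  have hclasses : criticalClasses k H = (classes.toFinset : Set (Quotient isoSetoid)) := by
    ext c
    rw [List.coe_toFinset, Set.mem_ofPred_eq, List.mem_map]
    constructor
    · rintro ⟨G, hcrit, hP5, hH, rfl⟩
      obtain ⟨Y, hY, hGY⟩ := (hL G).1 ⟨hcrit, hP5, hH⟩
      exact ⟨Y, hY, (Quotient.sound hGY).symm⟩
    · rintro ⟨Y, hY, rfl⟩
      obtain ⟨hcrit, hP5, hH⟩ := (hL Y).2 ⟨Y, hY, ⟨.refl⟩⟩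
      exact ⟨Y, hcrit, hP5, hH, rfl⟩
  have hnodup : classes.Nodup :=
    List.pairwise_map.2 (hpair.imp fun hXY heq => hXY (Quotient.exact heq))
  rw [hclasses, Set.encard_coe_eq_coe_finsetCard, List.toFinset_card_of_nodup hnodup,
    List.length_map]

/-! ### The two classifications -/

/-- The same graph with several orders. -/
def arrangements {n : ℕ} (adj : Fin n → List (Fin n)) (orders : List (List (Fin n))) :
    List Arrangement := orders.map (⟨n, adj, ·⟩)

theorem forall_mem_arrangements_isFree {V : Type*} {G : SimpleGraph V} {n : ℕ}
    {adj : Fin n → List (Fin n)} {orders : List (List (Fin n))} (h : orders ≠ []) :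
    (∀ X ∈ arrangements adj orders, IsFree X.graph G) ↔ IsFree (ofAdjLists adj) G := by
  obtain ⟨order, horder⟩ := List.exists_mem_of_ne_nil orders h
  rw [arrangements, List.forall_mem_map]
  exact ⟨fun hfree => hfree order horder, fun hfree _ _ => hfree⟩

/-- The path on five vertices, in several orders. The first two vertices of an order are the roles
of the new vertex and of its predecessor in the copies that the order excludes from the search; the
search succeeds without excluding all of them. -/
def paths : List Arrangement :=
  arrangements ![[1], [0, 2], [1, 3], [2, 4], [3]]
    [[0, 1, 2, 4, 3], [0, 2, 1, 3, 4], [0, 3, 1, 4, 2], [0, 4, 1, 3, 2], [1, 2, 0, 3, 4],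
      [2, 0, 3, 1, 4], [2, 1, 3, 0, 4]]

/-- The gem, in several orders as for `paths`. -/
def gems : List Arrangement :=
  arrangements ![[1, 4], [0, 2, 4], [1, 3, 4], [2, 4], [0, 1, 2, 3]]
    [[0, 1, 4, 2, 3], [0, 3, 2, 4, 1], [1, 0, 4, 2, 3], [4, 0, 3, 1, 2], [4, 1, 0, 2, 3]]

/-- The complement of `P₃ + P₂` on the standard vertex set, in several orders as for `paths`. -/
def coP3P2s : List Arrangement :=
  arrangements ![[2, 3, 4], [3, 4], [0, 3, 4], [0, 1, 2], [0, 1, 2]]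
    [[0, 2, 3, 4, 1], [0, 3, 2, 1, 4], [1, 3, 0, 2, 4], [3, 0, 2, 4, 1], [3, 1, 0, 2, 4],
      [3, 4, 0, 2, 1]]

/-- The complete graph on four vertices, the first graph of both lists. -/
def completeFour : Arrangement where
  size := 4
  adj := ![[1, 2, 3], [0, 2, 3], [0, 1, 3], [0, 1, 2]]
  order := [0, 1, 2, 3]

/-- The wheel with five spokes, the second graph of `coP3P2List`. -/
def wheel : Arrangement where
  size := 6
  adj := ![[1, 4, 5], [0, 2, 5], [1, 3, 5], [2, 4, 5], [0, 3, 5], [0, 1, 2, 3, 4]]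
  order := [5, 0, 1, 2, 3, 4]

/-- The Moser spindle, the second graph of `gemList` and the third one of `coP3P2List`. -/
def spindle : Arrangement where
  size := 7
  adj := ![[1, 4, 5], [0, 2, 5, 6], [1, 3, 6], [2, 4, 6], [0, 3, 5], [0, 1, 4], [1, 2, 3]]
  order := [1, 2, 6, 3, 0, 5, 4]

/-- The last graph of `gemList`. -/
def tenVertices : Arrangement where
  size := 10
  adj := ![[1, 4, 5], [0, 2, 5, 6, 7], [1, 3, 7], [2, 4, 6], [0, 3, 5, 6, 7],
    [0, 1, 4], [1, 3, 4, 8, 9], [1, 2, 4, 8, 9], [6, 7, 9], [6, 7, 8]]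
  order := [6, 7, 8, 9, 1, 4, 0, 5, 2, 3]

/-- The fourth graph of `coP3P2List`. -/
def crossed : Arrangement where
  size := 7
  adj := ![[1, 4, 5, 6], [0, 2, 5, 6], [1, 3, 5], [2, 4, 6], [0, 3, 5], [0, 1, 2, 4], [0, 1, 3]]
  order := [0, 1, 5, 6, 2, 4, 3]

/-- The fifth graph of `coP3P2List`. -/
def dense : Arrangement where
  size := 7
  adj := ![[1, 4, 5, 6], [0, 2, 5, 6], [1, 3, 5, 6], [2, 4, 6], [0, 3, 5], [0, 1, 2, 4],
    [0, 1, 2, 3]]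
  order := [0, 1, 5, 6, 2, 4, 3]

/-- The sixth graph of `coP3P2List`. -/
def fanned : Arrangement where
  size := 7
  adj := ![[1, 4, 5, 6], [0, 2, 5, 6], [1, 3, 6], [2, 4, 6], [0, 3, 5], [0, 1, 4], [0, 1, 2, 3]]
  order := [0, 1, 5, 6, 2, 4, 3]

theorem certificate_gem :
    Certificate 3 (paths ++ gems) completeFour [spindle, tenVertices] where
  isValid_forbidden := by decide +kernel
  isValid := by decide +kernel
  isCritical := by decide +kernel
  contains_eq_false := by decide +kernel
  pairwise := by decide +kernel
  exhaustive := by decide +kernel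

theorem certificate_coP3P2 :
    Certificate 3 (paths ++ coP3P2s) completeFour [wheel, spindle, crossed, dense, fanned] where
  isValid_forbidden := by decide +kernel
  isValid := by decide +kernel
  isCritical := by decide +kernel
  contains_eq_false := by decide +kernel
  pairwise := by decide +kernel
  exhaustive := by decide +kernel

theorem P5_eq : P5 = ofAdjLists ![[1], [0, 2], [1, 3], [2, 4], [3]] := by
  ext i j
  rw [SimpleGraph.pathGraph_adj]
  revert i j
  decide

/-- The complement of `P₃ + P₂` on the standard vertex set. -/
def coP3P2Iso : coP3P2 ≃g
    ofAdjLists (n := 5) ![[2, 3, 4], [3, 4], [0, 3, 4], [0, 1, 2], [0, 1, 2]] where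
  toEquiv := finSumFinEquiv
  map_rel_iff' := by
    rintro (a | a) (b | b) <;>
      simp only [coP3P2, SimpleGraph.compl_adj, SimpleGraph.sum_adj, SimpleGraph.pathGraph_adj,
        not_false_eq_true, and_true, ne_eq, reduceCtorEq, Sum.inl.injEq, Sum.inr.injEq] <;>
      revert a b <;> decide

section Classification

variable {V : Type*} {G : SimpleGraph V}

theorem isFree_P5_iff : IsFree P5 G ↔ ∀ X ∈ paths, IsFree X.graph G := by
  rw [paths, forall_mem_arrangements_isFree (List.cons_ne_nil _ _), P5_eq]

theorem isFree_gem_iff : IsFree gem G ↔ ∀ X ∈ gems, IsFree X.graph G := by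
  rw [gems, forall_mem_arrangements_isFree (List.cons_ne_nil _ _), gem]

theorem isFree_coP3P2_iff : IsFree coP3P2 G ↔ ∀ X ∈ coP3P2s, IsFree X.graph G := by
  rw [coP3P2s, forall_mem_arrangements_isFree (List.cons_ne_nil _ _)]
  exact not_congr ⟨fun ⟨φ⟩ => ⟨φ.comp coP3P2Iso.symm.toEmbedding⟩,
    fun ⟨φ⟩ => ⟨φ.comp coP3P2Iso.toEmbedding⟩⟩

theorem isVertexCritical_gem_free_iff :
    (IsVertexCritical G 4 ∧ IsFree P5 G ∧ IsFree gem G) ↔ ∃ H ∈ gemList, Nonempty (G ≃g H.2) := by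
  rw [isFree_P5_iff, isFree_gem_iff, ← List.forall_mem_append]
  exact certificate_gem.isVertexCritical_iff

theorem isVertexCritical_coP3P2_free_iff :
    (IsVertexCritical G 4 ∧ IsFree P5 G ∧ IsFree coP3P2 G) ↔
      ∃ H ∈ coP3P2List, Nonempty (G ≃g H.2) := by
  rw [isFree_P5_iff, isFree_coP3P2_iff, ← List.forall_mem_append]
  exact certificate_coP3P2.isVertexCritical_iff

end Classification

end

end VertexCritical

theorem theorem3p3_general :
    ((VertexCritical.criticalClasses 4 VertexCritical.gem).encard = 3 ∧
      ∀ (V : Type*) (G : SimpleGraph V),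
        (VertexCritical.IsVertexCritical G 4 ∧ VertexCritical.IsFree VertexCritical.P5 G ∧
            VertexCritical.IsFree VertexCritical.gem G) ↔
          ∃ H ∈ VertexCritical.gemList, Nonempty (G ≃g H.2)) ∧
    ((VertexCritical.criticalClasses 4 VertexCritical.coP3P2).encard = 6 ∧
      ∀ (V : Type*) (G : SimpleGraph V),
        (VertexCritical.IsVertexCritical G 4 ∧ VertexCritical.IsFree VertexCritical.P5 G ∧
            VertexCritical.IsFree VertexCritical.coP3P2 G) ↔
          ∃ H ∈ VertexCritical.coP3P2List, Nonempty (G ≃g H.2)) := by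
  refine ⟨⟨?_, fun _ _ => VertexCritical.isVertexCritical_gem_free_iff⟩,
    ⟨?_, fun _ _ => VertexCritical.isVertexCritical_coP3P2_free_iff⟩⟩
  · exact VertexCritical.encard_criticalClasses
      (fun _ => VertexCritical.isVertexCritical_gem_free_iff)
      VertexCritical.certificate_gem.pairwise_not_equiv
  · exact VertexCritical.encard_criticalClasses
      (fun _ => VertexCritical.isVertexCritical_coP3P2_free_iff)
      VertexCritical.certificate_coP3P2.pairwise_not_equiv

theorem theorem3p3 :
    ((VertexCritical.criticalClasses 4 VertexCritical.gem).encard = 3 ∧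
      ∀ (V : Type*) [Finite V] (G : SimpleGraph V),
        (VertexCritical.IsVertexCritical G 4 ∧ VertexCritical.IsFree VertexCritical.P5 G ∧
            VertexCritical.IsFree VertexCritical.gem G) ↔
          ∃ H ∈ VertexCritical.gemList, Nonempty (G ≃g H.2)) ∧
    ((VertexCritical.criticalClasses 4 VertexCritical.coP3P2).encard = 6 ∧
      ∀ (V : Type*) [Finite V] (G : SimpleGraph V),
        (VertexCritical.IsVertexCritical G 4 ∧ VertexCritical.IsFree VertexCritical.P5 G ∧
            VertexCritical.IsFree VertexCritical.coP3P2 G) ↔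
          ∃ H ∈ VertexCritical.coP3P2List, Nonempty (G ≃g H.2)) := by
  obtain ⟨⟨hgem, hgemList⟩, hcoP3P2, hcoP3P2List⟩ := theorem3p3_general
  exact ⟨⟨hgem, fun V _ => hgemList V⟩, hcoP3P2, fun V _ => hcoP3P2List V⟩
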